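/- There exist absolute constants $C>0$ and $k\in\mathbb N$ and a randomized algorithm $\mathcal A$ that receives $\varepsilon\in(0,1)$ and a simple graph $G$ on the vertex set $\{1,\dots,n\}$ (for any $n$), and outputs a pair $(\pi,\Lambda)$ consisting of an ordering $\pi$ of the vertices and a threshold $\Lambda\in\mathbb Z_{\ge 0}$, such that the following two properties hold for all $\varepsilon\in(0,1)$ and all $n$. (1) Privacy: $\mathcal A$ is $\varepsilon$-node differentially private, that is, $\Pr[\mathcal A(\varepsilon,G)\in S]\le e^{\varepsilon}\,\Pr[\mathcal A(\varepsilon,G')\in S]$ for every set $S$ of outputs and all graphs $G,G'$ on $\{1,\dots,n\}$ that differ only in edges incident to a single vertex. (2) Utility: Let $G$ be a graph on $\{1,\dots,n\}$ and let $\alpha$ be its arboricity, i.e. the minimum number of edge-disjoint forests into which its edge set decomposes; $\alpha$ is not given to the algorithm. The pair $(\pi,\Lambda)$ encodes an implicit vertex cover: every edge of $G$ is covered by its endpoints of degree (in $G$) strictly greater than $\Lambda$ if there is such an endpoint, and otherwise by its endpoint that appears earlier in $\pi$; let $C_{\pi,\Lambda}(G)$ be the set of vertices that cover at least one edge. Then,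 with probability at least $0.99$ over $(\pi,\Lambda)\leftarrow\mathcal A(\varepsilon,G)$, the set $C_{\pi,\Lambda}(G)$ is a vertex cover of $G$ and an $\widetilde O(\alpha/\varepsilon^2)$-approximation of a minimum vertex cover, that is, \[ |C_{\pi,\Lambda}(G)|\;\le\; C\cdot\frac{\alpha}{\varepsilon^{2}}\cdot\log^{k}\!\Bigl(2+\min\bigl\{n,\tfrac{\alpha}{\varepsilon^2}\bigr\}\Bigr)\cdot \mathrm{OPT}(G), \] where $\mathrm{OPT}(G)$ is the minimum size of a vertex cover of $G$. -/

import Mathlib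

/-- Two graphs on the same vertex set are node-neighbouring if one is obtained from the other by
replacing all edges incident to a single vertex `v`: they agree on all pairs that avoid `v`. -/
def NodeNeighboring {V : Type*} (G G' : SimpleGraph V) : Prop :=
  ∃ v : V, ∀ u w : V, u ≠ v → w ≠ v → (G.Adj u w ↔ G'.Adj u w)

/-- A randomized graph algorithm (with discrete output distributions) is `ε`-node differentially
private if `Pr[A(G) ∈ S] ≤ e ^ ε * Pr[A(G') ∈ S]` for all sets `S` of outputs and all
node-neighbouring `G`, `G'`. -/
def IsNodeDP {V Ω : Type*} (ε : ℝ) (A : SimpleGraph V → PMF Ω) : Prop :=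
  ∀ G G' : SimpleGraph V, NodeNeighboring G G' → ∀ S : Set Ω,
    (A G).toOuterMeasure S ≤ ENNReal.ofReal (Real.exp ε) * (A G').toOuterMeasure S

/-- The arboricity of a (finite) graph: the least number of edge-disjoint forests into which its
edge set can be decomposed. -/
noncomputable def arboricity {V : Type*} (G : SimpleGraph V) : ℕ :=
  sInf {k : ℕ | ∃ F : Fin k → SimpleGraph V,
    (∀ i, (F i).IsAcyclic) ∧ (∀ i j, i ≠ j → Disjoint (F i) (F j)) ∧ ⨆ i, F i = G}

/-- The degree of a vertex in a finite graph. -/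
noncomputable def vdeg {V : Type*} (G : SimpleGraph V) (v : V) : ℕ :=
  (G.neighborSet v).ncard

/-- An implicit vertex cover `(π, Λ)`: an ordering of the `n` vertices (`π v` is the position of
the vertex `v`) together with a degree threshold. -/
abbrev ImplicitVC (n : ℕ) : Type := Equiv.Perm (Fin n) × ℕ

/-- The vertex set that `(π, Λ)` encodes on the graph `G`. An edge is covered by an endpoint of
degree greater than `Λ` if there is one (by both endpoints if both are such), and otherwise by its
endpoint which appears earlier in `π`. The set consists of all vertices that cover some edge. -/
def ImplicitVC.decode {n : ℕ} (s : ImplicitVC n) (G : SimpleGraph (Fin n)) : Set (Fin n) :=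
  {v | ∃ w, G.Adj v w ∧
    (s.2 < vdeg G v ∨ (vdeg G v ≤ s.2 ∧ vdeg G w ≤ s.2 ∧ s.1 v < s.1 w))}

/-- `S` is a `ρ`-approximate minimum vertex cover of `G`: it is a vertex cover, and its size is at
most `ρ` times that of any vertex cover. -/
def IsApproxVertexCover {V : Type*} (G : SimpleGraph V) (ρ : ℝ) (S : Set V) : Prop :=
  G.IsVertexCover S ∧ ∀ T : Set V, G.IsVertexCover T → (S.ncard : ℝ) ≤ ρ * (T.ncard : ℝ)

/-!
The algorithm releases the arboricity `α` privately and derives the threshold from it; the ordering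
is the identity, independently of the graph.

*Privacy.* Changing the edges at one vertex `v` changes the arboricity by at most one, because the
star at `v` can serve as one additional forest (`arboricity_le_add_one_of_nodeNeighboring`). So it
suffices to output `m`, drawn with probability proportional to `r ^ |m - α|` for `r = e ^ (-ε / 2)`:
a shift of `α` by one changes each weight, and hence also the normalizing constant, by a factor of
at most `r⁻¹` (`discreteLaplace_toOuterMeasure_le`). The threshold is `Λ = 2 * (m + ⌈12 / ε⌉)`, a
function of `m`. A geometric tail bound shows that `2 * α ≤ Λ ≤ 2 * α + 52 / ε` holds with
probability at least `0.99`.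

*Utility.* Let `T` be a vertex cover and `2 * α ≤ Λ`. A vertex of degree greater than `Λ` outside
`T` sends all its edges to `T`. The edges of a forest can be oriented such that every vertex has
out-degree at most one, so there are at most `α * (|B| + |T|)` edges between a set `B` and `T`;
therefore the set `B` of such vertices satisfies `(Λ + 1) * |B| ≤ α * (|B| + |T|)`, which gives
`|B| ≤ |T|`. The other members of the decoded set have degree at most `Λ` and are either in `T` or
adjacent to a vertex of `T` of degree at most `Λ`, whatever the ordering is, so that there are at
most `(Λ + 1) * |T|` of them. Altogether the decoded cover has at most
`(Λ + 3) * |T| = O(α + 1 / ε) * |T|` elements (`ncard_decode_le`). For `α ≥ 1` this is at most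
`57 * (α / ε ^ 2) * |T|`, so the claimed bound holds even without its logarithmic factor; for
`α = 0` there are no edges.
-/

/-! ### Arboricity -/

/-- Forests that cover `G` need be neither disjoint nor contained in `G` in order to bound its
arboricity. -/
lemma arboricity_le_of_le_iSup {V : Type*} {G : SimpleGraph V} {k : ℕ}
    (F : Fin k → SimpleGraph V) (hF : ∀ i, (F i).IsAcyclic) (hG : G ≤ ⨆ i, F i) :
    arboricity G ≤ k := by
  refine Nat.sInf_le ⟨disjointed fun i => G ⊓ F i, fun i => ?_, fun i j hij => ?_, ?_⟩
  · exact (hF i).anti ((disjointed_le _ i).trans inf_le_right)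
  · exact disjoint_disjointed _ hij
  · rw [iSup_disjointed, ← inf_iSup_eq]
    exact inf_eq_left.2 hG

/-- On a finite vertex set the infimum in `arboricity` is attained, since the stars at all vertices
cover every graph. -/
lemma exists_forests_of_arboricity {n : ℕ} (G : SimpleGraph (Fin n)) :
    ∃ F : Fin (arboricity G) → SimpleGraph (Fin n),
      (∀ i, (F i).IsAcyclic) ∧ ⨆ i, F i = G := by
  have hne : {k : ℕ | ∃ F : Fin k → SimpleGraph (Fin n),
      (∀ i, (F i).IsAcyclic) ∧ (∀ i j, i ≠ j → Disjoint (F i) (F j)) ∧ ⨆ i, F i = G}.Nonempty := by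
    refine ⟨n, disjointed fun i => G ⊓ SimpleGraph.starGraph i, fun i => ?_, fun i j hij => ?_, ?_⟩
    · exact (SimpleGraph.isAcyclic_starGraph i).anti ((disjointed_le _ i).trans inf_le_right)
    · exact disjoint_disjointed _ hij
    · rw [iSup_disjointed, ← inf_iSup_eq, inf_eq_left]
      intro u v huv
      rw [SimpleGraph.iSup_adj]
      exact ⟨u, SimpleGraph.starGraph_center_adj huv.ne⟩
  obtain ⟨F, hF, -, hG⟩ := Nat.sInf_mem hne
  exact ⟨F, hF, hG⟩

lemma NodeNeighboring.symm {V : Type*} {G G' : SimpleGraph V} (h : NodeNeighboring G G') :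
    NodeNeighboring G' G := by
  obtain ⟨v, hv⟩ := h
  exact ⟨v, fun u w hu hw => (hv u w hu hw).symm⟩

lemma arboricity_le_add_one_of_nodeNeighboring {n : ℕ} {G G' : SimpleGraph (Fin n)}
    (h : NodeNeighboring G G') : arboricity G ≤ arboricity G' + 1 := by
  obtain ⟨v, hv⟩ := h
  obtain ⟨F, hF, hG'⟩ := exists_forests_of_arboricity G'
  refine arboricity_le_of_le_iSup (Fin.cons (SimpleGraph.starGraph v) F) (fun i => ?_) ?_
  · refine Fin.cases ?_ (fun i => ?_) i
    · exact SimpleGraph.isAcyclic_starGraph v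
    · exact hF i
  · intro u w huw
    rw [SimpleGraph.iSup_adj]
    by_cases hvu : u = v ∨ w = v
    · exact ⟨0, SimpleGraph.starGraph_adj.2 ⟨huw.ne, hvu⟩⟩
    · rw [not_or] at hvu
      have huw' := (hv u w hvu.1 hvu.2).1 huw
      rw [← hG', SimpleGraph.iSup_adj] at huw'
      obtain ⟨i, hi⟩ := huw'
      exact ⟨i.succ, hi⟩

/-- A forest has an orientation of out-degree at most one: every vertex points to the next vertex
on its path to a root of its component. -/
lemma SimpleGraph.IsAcyclic.exists_parent {V : Type*} {G : SimpleGraph V} (hG : G.IsAcyclic) :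
    ∃ f : V → V, ∀ u v, G.Adj u v → f u = v ∨ f v = u := by
  have hroot : ∀ v, G.Reachable v (Quot.out (G.connectedComponentMk v)) := fun v =>
    (SimpleGraph.ConnectedComponent.exact (Quot.out_eq (G.connectedComponentMk v))).symm
  have hsnd : ∀ v, ∃ w, ∀ x, x = Quot.out (G.connectedComponentMk v) →
      ∀ q : G.Walk v x, q.IsPath → q.snd = w := by
    intro v
    obtain ⟨p, hp⟩ := (hroot v).exists_isPath
    refine ⟨p.snd, ?_⟩
    rintro x rfl q hq
    have := (hG.subsingleton_path v _).elim ⟨q, hq⟩ ⟨p, hp⟩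
    rw [Subtype.mk.injEq] at this
    rw [this]
  choose f hf using hsnd
  refine ⟨f, fun u v huv => ?_⟩
  obtain ⟨p, hp⟩ := (hroot u).exists_isPath
  by_cases hv : v ∈ p.support
  · left
    rw [← hf u _ rfl p hp]
    exact (hG.eq_snd_of_adj_start hp huv hv).symm
  · right
    have hcomp : G.connectedComponentMk u = G.connectedComponentMk v :=
      SimpleGraph.ConnectedComponent.sound huv.reachable
    rw [← hf v _ (by rw [hcomp]) (SimpleGraph.Walk.cons huv.symm p) (hp.cons hv)]
    simp

/-- If every vertex of `B` has at least `d` neighbours in `T`, then `d * |B|` is at most the number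
of oriented forest edges that leave `B` or `T`. -/
lemma mul_card_le_arboricity_mul {n : ℕ} (G : SimpleGraph (Fin n)) (B T : Finset (Fin n)) (d : ℕ)
    (N : Fin n → Finset (Fin n)) (hN : ∀ b ∈ B, d ≤ (N b).card)
    (hNT : ∀ b ∈ B, ∀ t ∈ N b, t ∈ T ∧ G.Adj b t) :
    d * B.card ≤ arboricity G * (B.card + T.card) := by
  obtain ⟨F, hF, hG⟩ := exists_forests_of_arboricity G
  choose f hf using fun i => (hF i).exists_parent
  have hsub : B.sigma N ⊆ Finset.univ.biUnion fun i =>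
      (B.image fun b => (⟨b, f i b⟩ : Σ _ : Fin n, Fin n)) ∪ T.image fun t => ⟨f i t, t⟩ := by
    rintro ⟨b, t⟩ hbt
    rw [Finset.mem_sigma] at hbt
    obtain ⟨ht, hadj⟩ := hNT b hbt.1 t hbt.2
    rw [← hG, SimpleGraph.iSup_adj] at hadj
    obtain ⟨i, hi⟩ := hadj
    rw [Finset.mem_biUnion]
    refine ⟨i, Finset.mem_univ i, Finset.mem_union.2 ?_⟩
    rcases hf i b t hi with h | h
    · exact Or.inl (Finset.mem_image.2 ⟨b, hbt.1, by rw [h]⟩)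
    · exact Or.inr (Finset.mem_image.2 ⟨t, ht, by rw [h]⟩)
  calc d * B.card ≤ (B.sigma N).card := by
        rw [Finset.card_sigma, mul_comm, ← smul_eq_mul]
        exact Finset.card_nsmul_le_sum _ _ _ hN
    _ ≤ _ := Finset.card_le_card hsub
    _ ≤ Fintype.card (Fin (arboricity G)) * (B.card + T.card) :=
        Finset.card_biUnion_le_card_mul _ _ _ fun i _ =>
          (Finset.card_union_le _ _).trans
            (Nat.add_le_add Finset.card_image_le Finset.card_image_le)
    _ = _ := by rw [Fintype.card_fin]

/-! ### The decoded vertex cover -/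

lemma ImplicitVC.isVertexCover_decode {n : ℕ} (s : ImplicitVC n) (G : SimpleGraph (Fin n)) :
    G.IsVertexCover (s.decode G) := by
  intro u v huv
  by_cases hu : s.2 < vdeg G u
  · exact Or.inl ⟨v, huv, Or.inl hu⟩
  by_cases hv : s.2 < vdeg G v
  · exact Or.inr ⟨u, huv.symm, Or.inl hv⟩
  rw [not_lt] at hu hv
  rcases lt_or_gt_of_ne (s.1.injective.ne huv.ne) with h | h
  · exact Or.inl ⟨v, huv, Or.inr ⟨hu, hv, h⟩⟩
  · exact Or.inr ⟨u, huv.symm, Or.inr ⟨hv, hu, h⟩⟩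

lemma vdeg_eq_card_filter {n : ℕ} (G : SimpleGraph (Fin n)) [DecidableRel G.Adj] (v : Fin n) :
    vdeg G v = (Finset.univ.filter fun w => G.Adj v w).card := by
  rw [vdeg, ← Set.ncard_coe_finset]
  congr 1
  ext w
  simp

/-- Above a threshold of twice the arboricity there are at most as many vertices outside a vertex
cover as the cover has elements. -/
lemma card_high_degree_sdiff_le {n : ℕ} {G : SimpleGraph (Fin n)} {L : ℕ}
    (hL : 2 * arboricity G ≤ L) {B T : Finset (Fin n)} (hT : G.IsVertexCover (T : Set (Fin n)))
    (hB : ∀ b ∈ B, L < vdeg G b) (hBT : Disjoint B T) : B.card ≤ T.card := by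
  classical
  have key := mul_card_le_arboricity_mul G B T (L + 1)
    (fun b => Finset.univ.filter fun w => G.Adj b w)
    (fun b hb => by rw [← vdeg_eq_card_filter]; exact hB b hb)
    (fun b hb t ht => by
      have hbt := (Finset.mem_filter.1 ht).2
      exact ⟨(hT hbt).resolve_left (Finset.disjoint_left.1 hBT hb), hbt⟩)
  by_contra! h
  have h1 : arboricity G * (B.card + T.card) ≤ arboricity G * (2 * B.card) :=
    Nat.mul_le_mul_left _ (by omega)
  nlinarith

lemma ncard_decode_le {n : ℕ} {G : SimpleGraph (Fin n)} {s : ImplicitVC n}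
    (hs : 2 * arboricity G ≤ s.2) {T : Set (Fin n)} (hT : G.IsVertexCover T) :
    (s.decode G).ncard ≤ (s.2 + 3) * T.ncard := by
  classical
  obtain ⟨T, rfl⟩ := T.toFinite.exists_finset_coe
  set B : Finset (Fin n) := (Finset.univ.filter fun b => s.2 < vdeg G b) \ T with hBdef
  set N : Fin n → Finset (Fin n) := fun t => Finset.univ.filter fun w => G.Adj t w with hN
  have hB : B.card ≤ T.card := card_high_degree_sdiff_le hs hT
    (fun b hb => (Finset.mem_filter.1 (Finset.mem_sdiff.1 hb).1).2) Finset.sdiff_disjoint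
  have hsub : s.decode G ⊆
      ((B ∪ (T ∪ (T.filter fun t => vdeg G t ≤ s.2).biUnion N) : Finset (Fin n)) :
        Set (Fin n)) := by
    rintro v ⟨w, hvw, h⟩
    rw [Finset.mem_coe, Finset.mem_union, Finset.mem_union]
    by_cases hv : v ∈ T
    · exact Or.inr (Or.inl hv)
    rcases h with h | ⟨-, hw, -⟩
    · exact Or.inl (Finset.mem_sdiff.2 ⟨Finset.mem_filter.2 ⟨Finset.mem_univ v, h⟩, hv⟩)
    · refine Or.inr (Or.inr (Finset.mem_biUnion.2 ⟨w, Finset.mem_filter.2 ⟨?_, hw⟩, ?_⟩))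
      · exact (hT hvw).resolve_left hv
      · exact Finset.mem_filter.2 ⟨Finset.mem_univ v, hvw.symm⟩
  have hbi : ((T.filter fun t => vdeg G t ≤ s.2).biUnion N).card ≤ T.card * s.2 :=
    (Finset.card_biUnion_le_card_mul _ _ s.2 fun t ht => by
      rw [← vdeg_eq_card_filter]
      exact (Finset.mem_filter.1 ht).2).trans
      (Nat.mul_le_mul_right _ (Finset.card_filter_le _ _))
  calc (s.decode G).ncard ≤ _ := Set.ncard_le_ncard hsub (Finset.finite_toSet _)
    _ = _ := Set.ncard_coe_finset _
    _ ≤ B.card + (T.card + ((T.filter fun t => vdeg G t ≤ s.2).biUnion N).card) :=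
        (Finset.card_union_le _ _).trans (Nat.add_le_add_left (Finset.card_union_le _ _) _)
    _ ≤ (s.2 + 3) * T.card := by nlinarith
    _ = _ := by rw [Set.ncard_coe_finset]

lemma decode_eq_empty_of_arboricity_eq_zero {n : ℕ} {G : SimpleGraph (Fin n)}
    (h : arboricity G = 0) (s : ImplicitVC n) : s.decode G = ∅ := by
  obtain ⟨F, -, hG⟩ := exists_forests_of_arboricity G
  refine Set.eq_empty_of_forall_notMem ?_
  rintro v ⟨w, hvw, -⟩
  rw [← hG, SimpleGraph.iSup_adj] at hvw
  obtain ⟨i, -⟩ := hvw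
  rw [h] at i
  exact i.elim0

/-! ### Discrete Laplace noise -/

/-- The unnormalized weight `r ^ |j - d|` of `j`; as one of the two truncated differences is zero,
their sum is the distance. -/
noncomputable def laplaceWeight (r : ENNReal) (d j : ℕ) : ENNReal := r ^ ((j - d) + (d - j))

lemma tsum_laplaceWeight_ne_zero (r : ENNReal) (d : ℕ) : ∑' j, laplaceWeight r d j ≠ 0 := by
  rw [Ne, ENNReal.tsum_eq_zero, not_forall]
  exact ⟨d, by simp [laplaceWeight]⟩

/-- A change of the centre by one costs a factor of `r`. -/
lemma mul_laplaceWeight_le {r : ENNReal} (hr : r ≤ 1) {d d' : ℕ} (h : d ≤ d' + 1)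
    (h' : d' ≤ d + 1) (j : ℕ) : r * laplaceWeight r d j ≤ laplaceWeight r d' j := by
  rw [laplaceWeight, laplaceWeight, ← pow_succ']
  exact pow_le_pow_right_of_le_one' hr (by omega)

lemma tsum_laplaceWeight_ne_top {r : ENNReal} (hr0 : r ≠ 0) (hr : r < 1) (d : ℕ) :
    ∑' j, laplaceWeight r d j ≠ ⊤ := by
  have hle : ∑' j, laplaceWeight r d j ≤ ∑' j, (r ^ d)⁻¹ * r ^ j := by
    refine ENNReal.tsum_le_tsum fun j => ?_
    have hd : r ^ d ≠ 0 := pow_ne_zero _ hr0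
    have hd' : r ^ d ≠ ⊤ := ENNReal.pow_ne_top (hr.trans ENNReal.one_lt_top).ne
    rw [← ENNReal.mul_le_iff_le_inv hd hd', laplaceWeight, ← pow_add]
    exact pow_le_pow_right_of_le_one' hr.le (by omega)
  refine ne_top_of_le_ne_top ?_ hle
  rw [ENNReal.tsum_mul_left, ENNReal.tsum_geometric]
  exact ENNReal.mul_ne_top (ENNReal.inv_ne_top.2 (pow_ne_zero _ hr0))
    (ENNReal.inv_ne_top.2 (tsub_pos_of_lt hr).ne')

/-- The distribution on `ℕ` with probabilities proportional to `r ^ |j - d|`. -/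
noncomputable def discreteLaplace {r : ENNReal} (hr0 : r ≠ 0) (hr : r < 1) (d : ℕ) : PMF ℕ :=
  PMF.normalize (laplaceWeight r d) (tsum_laplaceWeight_ne_zero r d)
    (tsum_laplaceWeight_ne_top hr0 hr d)

/-- One factor `r⁻¹` comes from the weights and the other from the normalizing constants. -/
lemma discreteLaplace_apply_le {r : ENNReal} (hr0 : r ≠ 0) (hr : r < 1) {d d' : ℕ}
    (h : d ≤ d' + 1) (h' : d' ≤ d + 1) (j : ℕ) :
    discreteLaplace hr0 hr d j ≤ (r⁻¹ * r⁻¹) * discreteLaplace hr0 hr d' j := by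
  have hrt : r ≠ ⊤ := (hr.trans ENNReal.one_lt_top).ne
  have hw : laplaceWeight r d j ≤ r⁻¹ * laplaceWeight r d' j := by
    rw [mul_comm, ← div_eq_mul_inv, ENNReal.le_div_iff_mul_le (Or.inl hr0) (Or.inl hrt), mul_comm]
    exact mul_laplaceWeight_le hr.le h h' j
  have hZ : (∑' i, laplaceWeight r d i)⁻¹ ≤ r⁻¹ * (∑' i, laplaceWeight r d' i)⁻¹ := by
    rw [← ENNReal.mul_inv (Or.inl hr0) (Or.inl hrt), ENNReal.inv_le_inv, ← ENNReal.tsum_mul_left]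
    exact ENNReal.tsum_le_tsum fun i => mul_laplaceWeight_le hr.le h' h i
  rw [discreteLaplace, discreteLaplace, PMF.normalize_apply, PMF.normalize_apply]
  calc _ ≤ (r⁻¹ * laplaceWeight r d' j) * (r⁻¹ * (∑' i, laplaceWeight r d' i)⁻¹) :=
        mul_le_mul' hw hZ
    _ = _ := by ring

lemma discreteLaplace_toOuterMeasure_le {r : ENNReal} (hr0 : r ≠ 0) (hr : r < 1) {d d' : ℕ}
    (h : d ≤ d' + 1) (h' : d' ≤ d + 1) (S : Set ℕ) :
    (discreteLaplace hr0 hr d).toOuterMeasure S ≤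
      (r⁻¹ * r⁻¹) * (discreteLaplace hr0 hr d').toOuterMeasure S := by
  rw [PMF.toOuterMeasure_apply, PMF.toOuterMeasure_apply, ← ENNReal.tsum_mul_left]
  refine ENNReal.tsum_le_tsum fun j => ?_
  by_cases hj : j ∈ S
  · rw [Set.indicator_of_mem hj, Set.indicator_of_mem hj]
    exact discreteLaplace_apply_le hr0 hr h h' j
  · rw [Set.indicator_of_notMem hj]
    exact zero_le

/-- Each of the two tails, moved by `t + 1` towards the centre, is dominated by the whole
distribution, with weights larger by a factor of `r⁻¹ ^ (t + 1)`. -/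
lemma discreteLaplace_tail_le {r : ENNReal} (hr0 : r ≠ 0) (hr : r < 1) (d t : ℕ) :
    (discreteLaplace hr0 hr d).toOuterMeasure {j | d + t < j ∨ j + t < d} ≤ 2 * r ^ (t + 1) := by
  classical
  set w := laplaceWeight r d with hw
  set Z := ∑' j, w j with hZ
  have hZ0 : Z ≠ 0 := tsum_laplaceWeight_ne_zero r d
  have hZt : Z ≠ ⊤ := tsum_laplaceWeight_ne_top hr0 hr d
  have hinj : Function.Injective fun j : ℕ => j + (t + 1) := add_left_injective _
  have hright : ∑' j, (if d + t < j then w j else 0) ≤ r ^ (t + 1) * Z := by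
    have hsupp : Function.support (fun j => if d + t < j then w j else 0) ⊆
        Set.range fun j : ℕ => j + (t + 1) := by
      intro j hj
      have hj' : d + t < j := by
        by_contra hcon
        exact hj (if_neg hcon)
      exact ⟨j - (t + 1), by dsimp only; omega⟩
    rw [← hinj.tsum_eq hsupp, hZ, ← ENNReal.tsum_mul_left]
    refine ENNReal.tsum_le_tsum fun i => ?_
    split_ifs with hi
    · rw [hw, laplaceWeight, laplaceWeight, ← pow_add]
      exact (congrArg (r ^ ·) (by omega)).le
    · exact zero_le
  have hleft : ∑' j, (if j + t < d then w j else 0) ≤ r ^ (t + 1) * Z := by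
    calc _ ≤ ∑' j, r ^ (t + 1) * w (j + (t + 1)) := by
          refine ENNReal.tsum_le_tsum fun j => ?_
          split_ifs with hj
          · rw [hw, laplaceWeight, laplaceWeight, ← pow_add]
            exact (congrArg (r ^ ·) (by omega)).le
          · exact zero_le
      _ ≤ r ^ (t + 1) * Z := by
          rw [ENNReal.tsum_mul_left]
          exact mul_le_mul_right (ENNReal.tsum_comp_le_tsum_of_injective hinj w) _
  rw [PMF.toOuterMeasure_apply]
  calc _ ≤ ∑' j, ((if d + t < j then w j else 0) + (if j + t < d then w j else 0)) * Z⁻¹ := by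
        refine ENNReal.tsum_le_tsum fun j => ?_
        by_cases hj : j ∈ {j | d + t < j ∨ j + t < d}
        · rw [Set.indicator_of_mem hj, discreteLaplace, PMF.normalize_apply]
          refine mul_le_mul_left ?_ _
          rcases hj with hj | hj
          · rw [if_pos hj]
            exact le_self_add
          · rw [if_pos hj]
            exact le_add_self
        · rw [Set.indicator_of_notMem hj]
          exact zero_le
    _ ≤ (r ^ (t + 1) * Z + r ^ (t + 1) * Z) * Z⁻¹ := by
        rw [ENNReal.tsum_mul_right, ENNReal.tsum_add]
        exact mul_le_mul_left (add_le_add hright hleft) _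
    _ = 2 * r ^ (t + 1) * (Z * Z⁻¹) := by ring
    _ = _ := by rw [ENNReal.mul_inv_cancel hZ0 hZt, mul_one]

/-! ### The private algorithm -/

/-- The ratio `e ^ (-ε / 2)` of the noise. -/
noncomputable def noiseRatio (ε : ℝ) : ENNReal := ENNReal.ofReal (Real.exp (-(ε / 2)))

lemma noiseRatio_ne_zero (ε : ℝ) : noiseRatio ε ≠ 0 :=
  (ENNReal.ofReal_pos.2 (Real.exp_pos _)).ne'

lemma noiseRatio_lt_one {ε : ℝ} (hε : 0 < ε) : noiseRatio ε < 1 := by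
  rw [noiseRatio, ENNReal.ofReal_lt_one, Real.exp_lt_one_iff]
  linarith

lemma noiseRatio_inv_mul_inv (ε : ℝ) :
    (noiseRatio ε)⁻¹ * (noiseRatio ε)⁻¹ = ENNReal.ofReal (Real.exp ε) := by
  rw [noiseRatio, ← ENNReal.ofReal_inv_of_pos (Real.exp_pos _), ← Real.exp_neg,
    ← ENNReal.ofReal_mul (Real.exp_pos _).le, ← Real.exp_add]
  congr 2
  ring

/-- The threshold obtained from a noisy value of the arboricity; the slack `⌈12 / ε⌉` makes it at
least twice the true arboricity with high probability. -/
noncomputable def noisyThreshold (ε : ℝ) (m : ℕ) : ℕ := 2 * (m + ⌈12 / ε⌉₊)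

/-- The private algorithm: the identity ordering, and a threshold computed from the arboricity with
discrete Laplace noise. Values of `ε` that are not positive have no meaning and give an arbitrary
constant output. -/
noncomputable def privateVertexCover (ε : ℝ) (n : ℕ) (G : SimpleGraph (Fin n)) :
    PMF (ImplicitVC n) :=
  if hε : 0 < ε then
    (discreteLaplace (noiseRatio_ne_zero ε) (noiseRatio_lt_one hε) (arboricity G)).map
      fun m => (1, noisyThreshold ε m)
  else PMF.pure (1, 0)

lemma isNodeDP_privateVertexCover {ε : ℝ} (hε : 0 < ε) (n : ℕ) :
    IsNodeDP ε (privateVertexCover ε n) := by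
  intro G G' h S
  rw [privateVertexCover, privateVertexCover, dif_pos hε, dif_pos hε,
    PMF.toOuterMeasure_map_apply, PMF.toOuterMeasure_map_apply, ← noiseRatio_inv_mul_inv]
  exact discreteLaplace_toOuterMeasure_le _ _ (arboricity_le_add_one_of_nodeNeighboring h)
    (arboricity_le_add_one_of_nodeNeighboring h.symm) _

lemma two_mul_noiseRatio_pow_le {ε : ℝ} (hε : 0 < ε) :
    2 * noiseRatio ε ^ (⌈12 / ε⌉₊ + 1) ≤ 1 / 100 := by
  have hexp : Real.exp (-6) ≤ 1 / 200 := by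
    rw [Real.exp_neg, one_div]
    refine inv_anti₀ (by norm_num) ?_
    have h6 : Real.exp 6 = Real.exp 1 ^ 6 := by rw [← Real.exp_nat_mul]; norm_num
    rw [h6]
    calc (200 : ℝ) ≤ 2.7 ^ 6 := by norm_num
      _ ≤ _ := pow_le_pow_left₀ (by norm_num) (by linarith [Real.exp_one_gt_d9]) 6
  have hpow : Real.exp (-(ε / 2)) ^ (⌈12 / ε⌉₊ + 1) ≤ Real.exp (-6) := by
    rw [← Real.exp_nat_mul, Real.exp_le_exp]
    have hceil := (div_le_iff₀ hε).1 (Nat.le_ceil (12 / ε))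
    push_cast
    nlinarith
  rw [noiseRatio, ← ENNReal.ofReal_pow (Real.exp_pos _).le]
  calc _ ≤ 2 * ENNReal.ofReal (1 / 200) :=
        mul_le_mul_right (ENNReal.ofReal_le_ofReal (hpow.trans hexp)) _
    _ = ENNReal.ofReal (2 * (1 / 200)) := by rw [ENNReal.ofReal_mul (by norm_num)]; simp
    _ = ENNReal.ofReal (1 / 100) := by norm_num
    _ = 1 / 100 := by rw [ENNReal.ofReal_div_of_pos (by norm_num)]; simp

/-- With probability at least `0.99` the noise has absolute value at most `⌈12 / ε⌉`. -/
lemma le_discreteLaplace_near {ε : ℝ} (hε : 0 < ε) (d : ℕ) :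
    99 / 100 ≤ (discreteLaplace (noiseRatio_ne_zero ε) (noiseRatio_lt_one hε) d).toOuterMeasure
      {m | d ≤ m + ⌈12 / ε⌉₊ ∧ m ≤ d + ⌈12 / ε⌉₊} := by
  set P := discreteLaplace (noiseRatio_ne_zero ε) (noiseRatio_lt_one hε) d
  set t := ⌈12 / ε⌉₊
  have huniv : P.toOuterMeasure Set.univ = 1 :=
    (P.toOuterMeasure_apply_eq_one_iff _).2 (Set.subset_univ _)
  have hcover : (Set.univ : Set ℕ) ⊆
      {m | d ≤ m + t ∧ m ≤ d + t} ∪ {m | d + t < m ∨ m + t < d} := by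
    intro m _
    simp only [Set.mem_union, Set.mem_ofPred_eq]
    omega
  have hone : 1 ≤ P.toOuterMeasure {m | d ≤ m + t ∧ m ≤ d + t} + 1 / 100 := by
    refine huniv.ge.trans ?_
    refine (MeasureTheory.measure_mono hcover).trans ((MeasureTheory.measure_union_le _ _).trans ?_)
    exact add_le_add le_rfl ((discreteLaplace_tail_le _ _ d t).trans (two_mul_noiseRatio_pow_le hε))
  have hsub : (99 / 100 : ENNReal) = 1 - 1 / 100 := by
    refine ENNReal.eq_sub_of_add_eq (by simp) ?_
    rw [← ENNReal.add_div]
    norm_num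
    exact ENNReal.div_self (by norm_num) (by norm_num)
  rw [hsub]
  exact tsub_le_iff_right.2 hone

lemma isApproxVertexCover_decode {ε : ℝ} (hε : 0 < ε) (hε1 : ε < 1) {n : ℕ}
    (G : SimpleGraph (Fin n)) (σ : Equiv.Perm (Fin n)) {m : ℕ}
    (hlow : arboricity G ≤ m + ⌈12 / ε⌉₊) (hhigh : m ≤ arboricity G + ⌈12 / ε⌉₊) :
    IsApproxVertexCover G (57 * ((arboricity G : ℝ) / ε ^ 2))
      (ImplicitVC.decode (σ, noisyThreshold ε m) G) := by
  refine ⟨ImplicitVC.isVertexCover_decode _ G, fun T hT => ?_⟩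
  rcases Nat.eq_zero_or_pos (arboricity G) with h0 | hpos
  · rw [decode_eq_empty_of_arboricity_eq_zero h0, h0]
    simp
  have hcard := ncard_decode_le (s := (σ, noisyThreshold ε m)) (G := G)
    (by dsimp only [noisyThreshold]; omega) hT
  refine le_trans (b := ((noisyThreshold ε m + 3 : ℕ) : ℝ) * (T.ncard : ℝ))
    (by exact_mod_cast hcard) (mul_le_mul_of_nonneg_right ?_ (Nat.cast_nonneg _))
  have hα : (1 : ℝ) ≤ arboricity G := by exact_mod_cast hpos
  have hceil : ((⌈12 / ε⌉₊ : ℕ) : ℝ) < 12 / ε + 1 := Nat.ceil_lt_add_one (by positivity)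
  have hΛ : ((noisyThreshold ε m + 3 : ℕ) : ℝ) ≤
      2 * arboricity G + 4 * ((⌈12 / ε⌉₊ : ℕ) : ℝ) + 3 := by
    have : noisyThreshold ε m + 3 ≤ 2 * arboricity G + 4 * ⌈12 / ε⌉₊ + 3 := by
      dsimp only [noisyThreshold]
      omega
    exact_mod_cast this
  -- All three terms are at most a multiple of `α / ε ^ 2`, as `1 ≤ α` and `ε < 1`.
  have hdiv : 2 * (arboricity G : ℝ) + 4 * (12 / ε + 1) + 3 =
      (2 * arboricity G * ε ^ 2 + 48 * ε + 7 * ε ^ 2) / ε ^ 2 := by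
    field_simp
    ring
  have hsq : ε ^ 2 ≤ 1 := pow_le_one₀ hε.le hε1.le
  calc _ ≤ 2 * (arboricity G : ℝ) + 4 * (12 / ε + 1) + 3 := by linarith
    _ = _ := hdiv
    _ ≤ (57 * arboricity G) / ε ^ 2 := by
        refine div_le_div_of_nonneg_right ?_ (by positivity)
        nlinarith
    _ = _ := by ring

/-- The bound `Õ(α / ε ^ 2)` with explicit polylogarithmic factor; `C` and `k` are absolute. -/
theorem mainTheorem10 :
    ∃ (C : ℝ) (k : ℕ) (A : ℝ → (n : ℕ) → SimpleGraph (Fin n) → PMF (ImplicitVC n)),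
      ∀ ε : ℝ, 0 < ε → ε < 1 → ∀ n : ℕ,
        IsNodeDP ε (A ε n) ∧
        ∀ G : SimpleGraph (Fin n),
          (99 / 100 : ENNReal) ≤ (A ε n G).toOuterMeasure
            {s | IsApproxVertexCover G
              (C * ((arboricity G : ℝ) / ε ^ 2) *
                Real.log (2 + min (n : ℝ) ((arboricity G : ℝ) / ε ^ 2)) ^ k)
              (s.decode G)} := by
  refine ⟨57, 0, privateVertexCover, fun ε hε hε1 n => ⟨isNodeDP_privateVertexCover hε n, ?_⟩⟩
  intro G
  rw [privateVertexCover, dif_pos hε, PMF.toOuterMeasure_map_apply]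
  refine (le_discreteLaplace_near hε (arboricity G)).trans (MeasureTheory.measure_mono ?_)
  rintro m ⟨hlow, hhigh⟩
  simp only [Set.mem_preimage, Set.mem_ofPred_eq, pow_zero, mul_one]
  exact isApproxVertexCover_decode hε hε1 G 1 hlow hhigh
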